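/- Let $B$ be a von Neumann algebra with a normal faithful tracial state $\tau$, let $\sigma\colon\Gamma\to\operatorname{Aut}(B)$ be an action of a discrete group $\Gamma$ by $*$-automorphisms with $\tau\circ\sigma_g=\tau$ for all $g\in\Gamma$, and let $M=B\rtimes\Gamma$ be the crossed product von Neumann algebra, generated by $B$ and the natural unitaries $(u_g)_{g\in\Gamma}$ implementing the action, so that $u_gbu_g^*=\sigma_g(b)$ for $b\in B$. Let $E_B\colon M\to B$ be the canonical conditional expectation, for which $E_B(bu_g)=0$ for $b\in B$, $g\neq e$; equip $M$ with the trace $\tau\circ E_B$, and write $\|x\|_2=\tau(E_B(x^*x))^{1/2}$. Let $(v_n)_{n\in\mathbb N}$ be a sequence of unitaries in $M$. Each $v_n$ has a unique expansion $v_n=\sum_{g\in\Gamma}(v_n)_g\,u_g$ with $(v_n)_g\in B$ and the series converging unconditionally in $\|\cdot\|_2$ (that is, in $L^2(M)$); its Fourier coefficients are $(v_n)_g=E_B(v_nu_g^*)$. Moreover, $$\lim_{n\to\infty}\|E_B(xv_ny)\|_2=0\ \text{ for all } x,y\in M$$ if and only if $$\lim_{n\to\infty}\|(v_n)_g\|_2=0\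 \text{ for every } g\in\Gamma .$$ -/

import Mathlib

open scoped ComplexOrder ENNReal Topology lp

universe u v

noncomputable section

section VonNeumann

variable {H : Type u} [NormedAddCommGroup H] [InnerProductSpace ℂ H] [CompleteSpace H]

/-- The elements of a von Neumann algebra `B ⊆ B(H)`, as a type that carries its structure of a
unital `*`-algebra over `ℂ`. -/
abbrev VonNeumannAlgebra.Elem (B : VonNeumannAlgebra H) : Type u := B.toStarSubalgebra

/-- A von Neumann algebra is norm closed, being a commutant; hence `B.Elem` is a C*-algebra. -/
instance VonNeumannAlgebra.isClosed_toStarSubalgebra (B : VonNeumannAlgebra H) :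
    IsClosed (B.toStarSubalgebra : Set (H →L[ℂ] H)) := by
  have h : (B.toStarSubalgebra : Set (H →L[ℂ] H)) =
      Set.centralizer (Set.centralizer (B : Set (H →L[ℂ] H))) := by
    rw [B.centralizer_centralizer]; rfl
  rw [h]
  exact Set.isClosed_centralizer _

/-- The von Neumann algebra `(S ∪ S*)''` generated by a set `S` of bounded operators. -/
def VonNeumannAlgebra.generatedBy (S : Set (H →L[ℂ] H)) : VonNeumannAlgebra H where
  toStarSubalgebra :=
    StarSubalgebra.centralizer ℂ (StarSubalgebra.centralizer ℂ S : Set (H →L[ℂ] H))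
  centralizer_centralizer' := by
    have h : ((StarSubalgebra.centralizer ℂ
        (StarSubalgebra.centralizer ℂ S : Set (H →L[ℂ] H)) :
          StarSubalgebra ℂ (H →L[ℂ] H)) : Set (H →L[ℂ] H)) =
        Set.centralizer (StarSubalgebra.centralizer ℂ S : Set (H →L[ℂ] H)) := by
      rw [StarSubalgebra.coe_centralizer]
      congr 1
      refine Set.union_eq_self_of_subset_right fun a ha => ?_
      have h2 : star (star a) ∈ StarSubalgebra.centralizer ℂ S := star_mem ha
      rwa [star_star] at h2
    change Set.centralizer (Set.centralizer
      ((StarSubalgebra.centralizer ℂ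
        (StarSubalgebra.centralizer ℂ S : Set (H →L[ℂ] H)) :
          StarSubalgebra ℂ (H →L[ℂ] H)) : Set (H →L[ℂ] H))) = _
    rw [h, Set.centralizer_centralizer_centralizer]
    exact h.symm

theorem VonNeumannAlgebra.subset_generatedBy (S : Set (H →L[ℂ] H)) :
    S ⊆ (VonNeumannAlgebra.generatedBy S : Set (H →L[ℂ] H)) := by
  intro a ha
  change a ∈ StarSubalgebra.centralizer ℂ (StarSubalgebra.centralizer ℂ S : Set (H →L[ℂ] H))
  rw [StarSubalgebra.mem_centralizer_iff]
  intro g hg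
  have hs : star g ∈ StarSubalgebra.centralizer ℂ S := star_mem (s := StarSubalgebra.centralizer ℂ S) hg
  exact ⟨((StarSubalgebra.mem_centralizer_iff ℂ).1 hg a ha).1.symm,
    ((StarSubalgebra.mem_centralizer_iff ℂ).1 hs a ha).1.symm⟩

/-- `τ` is a normal (that is, `σ`-weakly continuous) faithful tracial state on the von Neumann
algebra `B ⊆ B(H)`. The `σ`-weakly continuous functionals are those of the form
`b ↦ ∑ₖ ⟨ηₖ, b ξₖ⟩` with `∑ₖ ‖ξₖ‖² < ∞` and `∑ₖ ‖ηₖ‖² < ∞`. -/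
structure IsNormalFaithfulTrace (B : VonNeumannAlgebra H) (τ : B.Elem →ₗ[ℂ] ℂ) : Prop where
  map_one : τ 1 = 1
  nonneg : ∀ b : B.Elem, 0 ≤ τ (star b * b)
  faithful : ∀ b : B.Elem, τ (star b * b) = 0 → b = 0
  tracial : ∀ a b : B.Elem, τ (a * b) = τ (b * a)
  normal : ∃ ξ η : ℕ → H, Summable (fun k => ‖ξ k‖ ^ 2) ∧ Summable (fun k => ‖η k‖ ^ 2) ∧
    ∀ b : B.Elem, HasSum (fun k => inner ℂ (η k) ((b : H →L[ℂ] H) (ξ k))) (τ b)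

/-- The `2`-norm `‖b‖₂ = τ(b* b)^{1/2}` of a state `τ`. -/
def twoNorm {B : VonNeumannAlgebra H} (τ : B.Elem →ₗ[ℂ] ℂ) (b : B.Elem) : ℝ :=
  Real.sqrt (τ (star b * b)).re

end VonNeumann

section Operators

variable {H : Type u} [NormedAddCommGroup H] [InnerProductSpace ℂ H]
variable {Γ : Type v}

/-- The diagonal operator `(T ξ)(h) = T_h (ξ(h))` on `ℓ²(Γ, H)` of a uniformly bounded
family of operators. -/
def diagOp (T : Γ → H →L[ℂ] H) (C : ℝ) (hT : ∀ h, ‖T h‖ ≤ C) :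
    lp (fun _ : Γ => H) 2 →L[ℂ] lp (fun _ : Γ => H) 2 :=
  have key : ∀ (h : Γ) (ξ : lp (fun _ : Γ => H) 2), ‖T h (ξ h)‖ ≤ ‖C • ξ h‖ := fun h ξ => by
    rw [norm_smul]
    exact ((T h).le_opNorm _).trans
      (mul_le_mul_of_nonneg_right ((hT h).trans (Real.le_norm_self C)) (norm_nonneg _))
  LinearMap.mkContinuous
    { toFun := fun ξ => ⟨fun h => T h (ξ h), (lp.memℓp (C • ξ)).mono' (fun h => key h ξ)⟩
      map_add' := fun ξ η => by ext h; simp; rfl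
      map_smul' := fun c ξ => by ext h; simp }
    ‖C‖ (fun ξ => by
      rw [← norm_smul]
      exact lp.norm_mono two_ne_zero (fun h => key h ξ))

theorem diagOp_apply (T : Γ → H →L[ℂ] H) (C : ℝ) (hT : ∀ h, ‖T h‖ ≤ C)
    (ξ : lp (fun _ : Γ => H) 2) (h : Γ) : diagOp T C hT ξ h = T h (ξ h) := rfl

/-- The left translation `(λ_g ξ)(h) = ξ(g⁻¹ h)` on `ℓ²(Γ, H)`. -/
def leftTranslation [Group Γ] (g : Γ) :
    lp (fun _ : Γ => H) 2 →L[ℂ] lp (fun _ : Γ => H) 2 :=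
  LinearMap.mkContinuous
    { toFun := fun ξ => ⟨fun h => ξ (g⁻¹ * h), memℓp_gen
        (((Equiv.mulLeft g⁻¹).summable_iff).2 ((lp.memℓp ξ).summable (by norm_num)))⟩
      map_add' := fun ξ η => by ext h; simp; rfl
      map_smul' := fun c ξ => by ext h; simp }
    1 (fun ξ => by
      rw [one_mul]
      refine lp.norm_le_of_tsum_le (by norm_num) (norm_nonneg _) (le_of_eq ?_)
      rw [lp.norm_rpow_eq_tsum (by norm_num)]
      exact (Equiv.mulLeft g⁻¹).tsum_eq (fun h => ‖ξ h‖ ^ (2 : ℝ≥0∞).toReal))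

theorem leftTranslation_apply [Group Γ] (g : Γ) (ξ : lp (fun _ : Γ => H) 2) (h : Γ) :
    leftTranslation g ξ h = ξ (g⁻¹ * h) := rfl

end Operators

section CrossedProduct

variable {H : Type u} [NormedAddCommGroup H] [InnerProductSpace ℂ H] [CompleteSpace H]
variable {B : VonNeumannAlgebra H} {Γ : Type v} [Group Γ]

/-- The representation `(π(b) ξ)(h) = σ_{h⁻¹}(b) ξ(h)` of `B` on `ℓ²(Γ, H)`. -/
def crossedRep (σ : Γ →* (B.Elem ≃⋆ₐ[ℂ] B.Elem)) (b : B.Elem) :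
    lp (fun _ : Γ => H) 2 →L[ℂ] lp (fun _ : Γ => H) 2 :=
  diagOp (fun h => (σ h⁻¹ b : H →L[ℂ] H)) ‖b‖
    (fun h => le_of_eq (StarAlgEquiv.norm_map (σ h⁻¹) b))

/-- The crossed product `B ⋊ Γ`: the von Neumann algebra on `ℓ²(Γ, H)` generated by the operators
`π(b)`, `b ∈ B`, and `λ_g`, `g ∈ Γ`. -/
def crossedProduct (σ : Γ →* (B.Elem ≃⋆ₐ[ℂ] B.Elem)) :
    VonNeumannAlgebra (lp (fun _ : Γ => H) 2) :=
  VonNeumannAlgebra.generatedBy (Set.range (crossedRep σ) ∪ Set.range leftTranslation)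

/-- The inclusion `B ⊆ B ⋊ Γ`, `b ↦ π(b)`. -/
def crossedIncl (σ : Γ →* (B.Elem ≃⋆ₐ[ℂ] B.Elem)) (b : B.Elem) : (crossedProduct σ).Elem :=
  ⟨crossedRep σ b, VonNeumannAlgebra.subset_generatedBy _ (Or.inl ⟨b, rfl⟩)⟩

/-- The unitaries `u_g ∈ B ⋊ Γ` implementing the action. -/
def crossedUnitary (σ : Γ →* (B.Elem ≃⋆ₐ[ℂ] B.Elem)) (g : Γ) : (crossedProduct σ).Elem :=
  ⟨leftTranslation g, VonNeumannAlgebra.subset_generatedBy _ (Or.inr ⟨g, rfl⟩)⟩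

open Classical in
/-- The compression `ξ ↦ (x (δ_e ⊗ ξ))(e)` of an operator on `ℓ²(Γ, H)` to `δ_e ⊗ H = H`. -/
def compressOne (x : lp (fun _ : Γ => H) 2 →L[ℂ] lp (fun _ : Γ => H) 2) : H →L[ℂ] H :=
  (lp.evalCLM ℂ (fun _ : Γ => H) 2 1).comp
    (x.comp (lp.singleContinuousLinearMap ℂ (fun _ : Γ => H) 2 1))

open Classical in
/-- The compression of an element of `B ⋊ Γ` to `δ_e ⊗ H` lies in `B`. -/
theorem compressOne_mem (σ : Γ →* (B.Elem ≃⋆ₐ[ℂ] B.Elem)) (x : (crossedProduct σ).Elem) :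
    compressOne x.1 ∈ B.toStarSubalgebra := by
  change _ ∈ B
  refine (congrArg (fun S : VonNeumannAlgebra H => compressOne x.1 ∈ S)
    B.commutant_commutant).mp ?_
  rw [VonNeumannAlgebra.mem_commutant_iff]
  intro c hc
  have hcomm : ∀ c ∈ B.commutant,
      diagOp (fun _ : Γ => c) ‖c‖ (fun _ => le_rfl) * x.1
        = x.1 * diagOp (fun _ : Γ => c) ‖c‖ (fun _ => le_rfl) := by
    intro c hc
    have key : ∀ c ∈ B.commutant, ∀ s ∈ Set.range (crossedRep σ) ∪ Set.range leftTranslation,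
        s * diagOp (fun _ : Γ => c) ‖c‖ (fun _ => le_rfl)
          = diagOp (fun _ : Γ => c) ‖c‖ (fun _ => le_rfl) * s := by
      rintro c hc s (⟨b, rfl⟩ | ⟨g, rfl⟩)
      · ext ξ h
        have := VonNeumannAlgebra.mem_commutant_iff.1 hc (σ h⁻¹ b : H →L[ℂ] H) (σ h⁻¹ b).2
        exact congrArg (fun T : H →L[ℂ] H => T (ξ h)) this
      · rfl
    have hstar : star (diagOp (fun _ : Γ => c) ‖c‖ (fun _ => le_rfl))
        = diagOp (fun _ : Γ => star c) ‖star c‖ (fun _ => le_rfl) := by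
      rw [ContinuousLinearMap.star_eq_adjoint]
      symm
      rw [ContinuousLinearMap.eq_adjoint_iff]
      intro ξ η
      rw [lp.inner_eq_tsum, lp.inner_eq_tsum]
      refine tsum_congr fun h => ?_
      rw [diagOp_apply, diagOp_apply, ContinuousLinearMap.star_eq_adjoint]
      exact ContinuousLinearMap.adjoint_inner_left _ _ _
    have hmem : diagOp (fun _ : Γ => c) ‖c‖ (fun _ => le_rfl) ∈ StarSubalgebra.centralizer ℂ
        (Set.range (crossedRep σ) ∪ Set.range (leftTranslation (H := H) (Γ := Γ))) := by
      rw [StarSubalgebra.mem_centralizer_iff]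
      intro s hs
      refine ⟨key c hc s hs, ?_⟩
      have := congrArg star (key (star c) (star_mem hc) s hs)
      rw [← hstar, star_mul, star_mul, star_star] at this
      exact this.symm
    exact ((StarSubalgebra.mem_centralizer_iff ℂ).1 x.2 _ hmem).1
  have h1 := hcomm c hc
  ext ξ
  have h2 := congrArg (fun T : lp (fun _ : Γ => H) 2 →L[ℂ] lp (fun _ : Γ => H) 2 =>
    T (lp.single 2 1 ξ) 1) h1
  have h3 : diagOp (fun _ : Γ => c) ‖c‖ (fun _ => le_rfl) (lp.single 2 1 ξ)
      = lp.single 2 1 (c ξ) := by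
    ext h
    rw [diagOp_apply]
    by_cases hh : h = 1
    · subst hh; simp
    · rw [lp.single_apply_ne _ _ _ hh, lp.single_apply_ne _ _ _ hh, map_zero]
  simp only [mul_apply_eq_comp, h3] at h2
  exact h2

/-- The canonical conditional expectation `E_B : B ⋊ Γ → B`, with `E_B(∑ b_g u_g) = b_e`: the
compression to `δ_e ⊗ H`. -/
def condExpB (σ : Γ →* (B.Elem ≃⋆ₐ[ℂ] B.Elem)) : (crossedProduct σ).Elem →ₗ[ℂ] B.Elem where
  toFun x := ⟨compressOne x.1, compressOne_mem σ x⟩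
  map_add' _ _ := rfl
  map_smul' c x := by
    ext ξ
    rfl

/-- The trace `τ ∘ E_B` on `B ⋊ Γ` induced by the trace `τ` on `B`. -/
def crossedTrace (σ : Γ →* (B.Elem ≃⋆ₐ[ℂ] B.Elem)) (τ : B.Elem →ₗ[ℂ] ℂ) :
    (crossedProduct σ).Elem →ₗ[ℂ] ℂ :=
  τ ∘ₗ condExpB σ

/-- The Fourier coefficient `(x)_g = E_B(x u_g*)`. -/
def crossedCoeff (σ : Γ →* (B.Elem ≃⋆ₐ[ℂ] B.Elem)) (x : (crossedProduct σ).Elem) (g : Γ) :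
    B.Elem :=
  condExpB σ (x * star (crossedUnitary σ g))

/-- `x = ∑_g c_g u_g`, the series converging unconditionally in the `2`-norm, that is, in
`L²(B ⋊ Γ)`. -/
def HasFourierExpansion (σ : Γ →* (B.Elem ≃⋆ₐ[ℂ] B.Elem)) (τ : B.Elem →ₗ[ℂ] ℂ)
    (x : (crossedProduct σ).Elem) (c : Γ → B.Elem) : Prop :=
  Filter.Tendsto
    (fun F : Finset Γ => twoNorm (crossedTrace σ τ)
      (x - ∑ g ∈ F, crossedIncl σ (c g) * crossedUnitary σ g))
    Filter.atTop (𝓝 0)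

end CrossedProduct

end

/-! Write $\|\cdot\|_2$ for both 2-norms. One implication is the case $x=1$, $y=u_g^*$. For the
other, moving unitaries across $E_B$ gives
$E_B(au_g\,w\,cu_h)=a\,\sigma_g((w)_{(hg)^{-1}})\,\sigma_{h^{-1}}(c)$, so for monomials $x,y$ the
2-norm is at most $\|a\|\|c\|$ times that of one Fourier coefficient. General $x,y$ are approximated
in $\|\cdot\|_2$ by finite sums of monomials. Unitarity of $v_n$ makes the errors uniform in $n$:
$\|xv_n(y-y')\|_2\le\|x\|\|y-y'\|_2$ and $\|(x-x')v_ny'\|_2\le\|y'\|\|x-x'\|_2$. Replacing $y$ first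
fixes $\|y'\|$ before $x'$ is chosen, so no bound on $\|x'\|$ is needed.

Parseval's identity (`hasSum_twoNormSq_crossedCoeff`) gives the approximation, the expansion and its
uniqueness, the 2-norm contractivity of $E_B$ and $\|x^*\|_2=\|x\|_2$. It is read off the column
$x(\delta_e\otimes\xi)$, whose entries are $E_B(u_g^*x)\xi$. Passing to $E_B(xu_g^*)$ needs
$E_B\circ\operatorname{Ad}u_g=\sigma_g\circ E_B$ (`condExpB_conj`), which holds on monomials and
extends to $M$ by normality and a bicommutant argument. -/

/-! ### Normal functionals and the bicommutant -/

section Density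

variable {H : Type u} [NormedAddCommGroup H] [InnerProductSpace ℂ H]

/-- The amplification `x ⊗ 1` of `x` on `ℓ²(ι, H)`. -/
noncomputable abbrev amplification (ι : Type*) (x : H →L[ℂ] H) :
    lp (fun _ : ι => H) 2 →L[ℂ] lp (fun _ : ι => H) 2 :=
  diagOp (fun _ => x) ‖x‖ (fun _ => le_rfl)

theorem amplification_mul {ι : Type*} (x y : H →L[ℂ] H) (ξ : lp (fun _ : ι => H) 2) :
    amplification ι (x * y) ξ = amplification ι x (amplification ι y ξ) := by
  ext i
  simp [diagOp_apply]

theorem amplification_single {ι : Type*} [DecidableEq ι] (x : H →L[ℂ] H) (i : ι) (ζ : H) :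
    amplification ι x (lp.single 2 i ζ) = lp.single 2 i (x ζ) := by
  ext j
  rw [diagOp_apply]
  by_cases h : j = i
  · subst h; simp
  · rw [lp.single_apply_ne _ _ _ h, lp.single_apply_ne _ _ _ h, map_zero]

variable [CompleteSpace H]

theorem amplification_inner {ι : Type*} (x : H →L[ℂ] H) (ξ η : lp (fun _ : ι => H) 2) :
    inner ℂ (amplification ι (star x) ξ) η = inner ℂ ξ (amplification ι x η) := by
  rw [lp.inner_eq_tsum, lp.inner_eq_tsum]
  refine tsum_congr fun i => ?_
  rw [diagOp_apply, diagOp_apply, ContinuousLinearMap.star_eq_adjoint]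
  exact ContinuousLinearMap.adjoint_inner_left _ _ _

/-- Invariance of `S` under `star t` makes its orthogonal complement invariant under `t`, so `t`
respects the decomposition of `ξ`. -/
theorem starProjection_commute_of_invariant (S : Submodule ℂ H) [S.HasOrthogonalProjection]
    (t : H →L[ℂ] H) (ht : ∀ s ∈ S, t s ∈ S) (ht' : ∀ s ∈ S, star t s ∈ S) (ξ : H) :
    S.starProjection (t ξ) = t (S.starProjection ξ) := by
  refine Submodule.eq_starProjection_of_mem_orthogonal
    (ht _ (Submodule.starProjection_apply_mem S ξ)) ?_
  rw [← map_sub, Submodule.mem_orthogonal]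
  intro s hs
  rw [← ContinuousLinearMap.adjoint_inner_left]
  exact (Submodule.mem_orthogonal S _).1 (S.sub_starProjection_mem_orthogonal ξ) _ (ht' s hs)

open Classical in
/-- A form of the density theorem for the `σ`-weak topology: a normal functional that vanishes on
a `*`-closed monoid of operators vanishes on its bicommutant. -/
theorem inner_amplification_eq_zero_of_bicommutant {ι : Type*} (T : Set (H →L[ℂ] H))
    (hone : 1 ∈ T) (hmul : ∀ s ∈ T, ∀ t ∈ T, s * t ∈ T) (hstar : ∀ t ∈ T, star t ∈ T)
    (x : H →L[ℂ] H) (hx : ∀ c : H →L[ℂ] H, (∀ t ∈ T, t * c = c * t) → c * x = x * c)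
    (ξ η : lp (fun _ : ι => H) 2) (h : ∀ t ∈ T, inner ℂ η (amplification ι t ξ) = 0) :
    inner ℂ η (amplification ι x ξ) = 0 := by
  set S : Submodule ℂ (lp (fun _ : ι => H) 2) :=
    (Submodule.span ℂ ((fun t => amplification ι t ξ) '' T)).topologicalClosure
  have hclosed : IsClosed (S : Set (lp (fun _ : ι => H) 2)) :=
    Submodule.isClosed_topologicalClosure _
  have : CompleteSpace S := hclosed.completeSpace_coe
  have hinv : ∀ t ∈ T, ∀ s ∈ S, amplification ι t s ∈ S := by
    intro t ht s hs
    have hle : S ≤ S.comap (amplification ι t).toLinearMap := by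
      refine Submodule.topologicalClosure_minimal _ (Submodule.span_le.2 ?_)
        (hclosed.preimage (amplification ι t).continuous)
      rintro _ ⟨s, hs, rfl⟩
      change amplification ι t (amplification ι s ξ) ∈ S
      rw [← amplification_mul]
      exact Submodule.le_topologicalClosure _ (Submodule.subset_span ⟨_, hmul t ht s hs, rfl⟩)
    exact hle hs
  have hadj : ∀ t : H →L[ℂ] H, star (amplification ι t) = amplification ι (star t) := by
    intro t
    rw [ContinuousLinearMap.star_eq_adjoint]
    symm
    rw [ContinuousLinearMap.eq_adjoint_iff]
    exact fun a b => amplification_inner t a b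
  have hcomm : ∀ t ∈ T, ∀ ζ, S.starProjection (amplification ι t ζ)
      = amplification ι t (S.starProjection ζ) := by
    intro t ht ζ
    refine starProjection_commute_of_invariant S _ (hinv t ht) ?_ ζ
    rw [hadj]
    exact hinv _ (hstar t ht)
  -- The matrix entries of the projection commute with `T`, hence with `x`; so the projection
  -- commutes with the amplification of `x`.
  have hentry : ∀ (i j : ι) (ζ : H), S.starProjection (lp.single 2 j (x ζ)) i
      = x (S.starProjection (lp.single 2 j ζ) i) := by
    intro i j ζ
    let c : H →L[ℂ] H := (lp.evalCLM ℂ (fun _ : ι => H) 2 i).comp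
      (S.starProjection.comp (lp.singleContinuousLinearMap ℂ (fun _ : ι => H) 2 j))
    have hc : ∀ θ, c θ = S.starProjection (lp.single 2 j θ) i := fun θ => rfl
    have := hx c fun t ht => by
      ext θ
      change t (c θ) = c (t θ)
      rw [hc, hc, ← amplification_single, hcomm t ht, diagOp_apply]
    exact congrArg (fun F : H →L[ℂ] H => F ζ) this
  have hxcomm : ∀ ζ, S.starProjection (amplification ι x ζ)
      = amplification ι x (S.starProjection ζ) := by
    intro ζ
    have hsum := lp.hasSum_single (p := 2) (by norm_num) ζ
    have h1 := hsum.mapL (S.starProjection ∘L amplification ι x)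
    have h2 := hsum.mapL (amplification ι x ∘L S.starProjection)
    refine h1.unique ?_
    refine (congrArg (fun F => HasSum F _) (funext fun j => ?_)).mpr h2
    ext i
    change S.starProjection (amplification ι x (lp.single 2 j (ζ j))) i
      = amplification ι x (S.starProjection (lp.single 2 j (ζ j))) i
    rw [amplification_single, hentry, diagOp_apply]
  have hξ : ξ ∈ S := by
    refine Submodule.le_topologicalClosure _ (Submodule.subset_span ⟨1, hone, ?_⟩)
    ext i
    rfl
  have hmem : amplification ι x ξ ∈ S := by
    rw [← Submodule.starProjection_eq_self_iff, hxcomm, Submodule.starProjection_eq_self_iff.2 hξ]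
  have hle : S ≤ (ℂ ∙ η)ᗮ := by
    refine Submodule.topologicalClosure_minimal _ (Submodule.span_le.2 ?_)
      (Submodule.isClosed_orthogonal _)
    rintro _ ⟨t, ht, rfl⟩
    exact Submodule.mem_orthogonal_singleton_iff_inner_right.2 (h t ht)
  exact Submodule.mem_orthogonal_singleton_iff_inner_right.1 (hle hmem)

/-- The density theorem for a pair of normal functionals, given by square summable families. -/
theorem eq_of_hasSum_of_bicommutant {ι : Type*} (T : Set (H →L[ℂ] H))
    (hone : 1 ∈ T) (hmul : ∀ s ∈ T, ∀ t ∈ T, s * t ∈ T) (hstar : ∀ t ∈ T, star t ∈ T)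
    (x : H →L[ℂ] H) (hx : ∀ c : H →L[ℂ] H, (∀ t ∈ T, t * c = c * t) → c * x = x * c)
    {ξ η ξ' η' : ι → H} (hξ : Summable fun i => ‖ξ i‖ ^ 2) (hη : Summable fun i => ‖η i‖ ^ 2)
    (hξ' : Summable fun i => ‖ξ' i‖ ^ 2) (hη' : Summable fun i => ‖η' i‖ ^ 2)
    (h : ∀ t ∈ T, ∑' i, inner ℂ (η i) (t (ξ i)) = ∑' i, inner ℂ (η' i) (t (ξ' i))) :
    ∑' i, inner ℂ (η i) (x (ξ i)) = ∑' i, inner ℂ (η' i) (x (ξ' i)) := by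
  have mem : ∀ {ζ : ι → H}, (Summable fun i => ‖ζ i‖ ^ 2) → Memℓp ζ 2 := fun hζ =>
    memℓp_gen (by simpa using hζ)
  have memSum : ∀ {ζ ζ' : ι → H}, (Summable fun i => ‖ζ i‖ ^ 2) →
      (Summable fun i => ‖ζ' i‖ ^ 2) → Memℓp (Sum.elim ζ ζ') 2 := by
    intro ζ ζ' h1 h2
    refine memℓp_gen ?_
    have := Summable.sum (fun i : ι ⊕ ι => ‖(Sum.elim ζ ζ' i : H)‖ ^ 2) h1 h2
    simpa using this
  -- On a doubled index set with a sign on `η'`, the difference of the two functionals is a single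
  -- one.
  let a : lp (fun _ : ι ⊕ ι => H) 2 := ⟨Sum.elim ξ ξ', memSum hξ hξ'⟩
  let b : lp (fun _ : ι ⊕ ι => H) 2 :=
    ⟨Sum.elim η (fun i => -η' i), memSum hη (by simpa using hη')⟩
  have key : ∀ t : H →L[ℂ] H, inner ℂ b (amplification _ t a)
      = ∑' i, inner ℂ (η i) (t (ξ i)) - ∑' i, inner ℂ (η' i) (t (ξ' i)) := by
    intro t
    have s1 := lp.summable_inner (𝕜 := ℂ) (⟨η, mem hη⟩ : lp (fun _ : ι => H) 2)
      (amplification ι t ⟨ξ, mem hξ⟩)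
    have s2 := lp.summable_inner (𝕜 := ℂ) (⟨η', mem hη'⟩ : lp (fun _ : ι => H) 2)
      (amplification ι t ⟨ξ', mem hξ'⟩)
    refine (lp.hasSum_inner b (amplification _ t a)).unique ?_
    rw [sub_eq_add_neg, ← tsum_neg]
    refine HasSum.sum (f := fun i => inner ℂ (b i) (amplification _ t a i)) s1.hasSum ?_
    refine (congrArg (fun F => HasSum F _) (funext fun i => ?_)).mpr s2.neg.hasSum
    exact inner_neg_left _ _
  have := inner_amplification_eq_zero_of_bicommutant T hone hmul hstar x hx a b
    fun t ht => by rw [key, h t ht, sub_self]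
  rwa [key, sub_eq_zero] at this

end Density

/-! ### Algebra of the crossed product and equivariance of the conditional expectation -/

section CrossedAlgebra

variable {H : Type u} [NormedAddCommGroup H] [InnerProductSpace ℂ H] [CompleteSpace H]
variable {B : VonNeumannAlgebra H} {Γ : Type v} [Group Γ]
variable (σ : Γ →* (B.Elem ≃⋆ₐ[ℂ] B.Elem))

theorem crossedRep_apply (b : B.Elem) (ξ : lp (fun _ : Γ => H) 2) (h : Γ) :
    crossedRep σ b ξ h = (σ h⁻¹ b : H →L[ℂ] H) (ξ h) := rfl

theorem crossedUnitary_one : crossedUnitary σ 1 = 1 := by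
  ext ξ h
  change ξ (1⁻¹ * h) = ξ h
  simp

theorem crossedUnitary_mul (g h : Γ) :
    crossedUnitary σ (g * h) = crossedUnitary σ g * crossedUnitary σ h := by
  ext ξ k
  change ξ ((g * h)⁻¹ * k) = ξ (h⁻¹ * (g⁻¹ * k))
  rw [mul_inv_rev, mul_assoc]

theorem crossedUnitary_mul_inv (g : Γ) : crossedUnitary σ g * crossedUnitary σ g⁻¹ = 1 := by
  rw [← crossedUnitary_mul, mul_inv_cancel, crossedUnitary_one]

theorem crossedUnitary_inv_mul (g : Γ) : crossedUnitary σ g⁻¹ * crossedUnitary σ g = 1 := by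
  rw [← crossedUnitary_mul, inv_mul_cancel, crossedUnitary_one]

theorem star_crossedUnitary (g : Γ) : star (crossedUnitary σ g) = crossedUnitary σ g⁻¹ := by
  refine Subtype.ext ?_
  change star (leftTranslation (H := H) g) = leftTranslation g⁻¹
  rw [ContinuousLinearMap.star_eq_adjoint]
  symm
  rw [ContinuousLinearMap.eq_adjoint_iff]
  intro ξ η
  rw [lp.inner_eq_tsum, lp.inner_eq_tsum]
  refine ((Equiv.mulLeft g⁻¹).tsum_eq _).symm.trans (tsum_congr fun h => ?_)
  simp [leftTranslation_apply]

theorem crossedIncl_one : crossedIncl σ 1 = 1 := by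
  ext ξ h
  change (σ h⁻¹ 1 : H →L[ℂ] H) (ξ h) = ξ h
  simp

theorem crossedIncl_mul (a b : B.Elem) :
    crossedIncl σ (a * b) = crossedIncl σ a * crossedIncl σ b := by
  ext ξ h
  change (σ h⁻¹ (a * b) : H →L[ℂ] H) (ξ h) = (σ h⁻¹ a : H →L[ℂ] H) ((σ h⁻¹ b : H →L[ℂ] H) (ξ h))
  simp

theorem star_crossedIncl (b : B.Elem) : star (crossedIncl σ b) = crossedIncl σ (star b) := by
  refine Subtype.ext ?_
  change star (crossedRep σ b) = crossedRep σ (star b)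
  rw [ContinuousLinearMap.star_eq_adjoint]
  symm
  rw [ContinuousLinearMap.eq_adjoint_iff]
  intro ξ η
  rw [lp.inner_eq_tsum, lp.inner_eq_tsum]
  refine tsum_congr fun h => ?_
  rw [crossedRep_apply, crossedRep_apply, map_star]
  exact ContinuousLinearMap.adjoint_inner_left _ _ _

theorem crossedUnitary_mul_crossedIncl (g : Γ) (b : B.Elem) :
    crossedUnitary σ g * crossedIncl σ b = crossedIncl σ (σ g b) * crossedUnitary σ g := by
  ext ξ h
  change (σ (g⁻¹ * h)⁻¹ b : H →L[ℂ] H) (ξ (g⁻¹ * h))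
    = (σ h⁻¹ (σ g b) : H →L[ℂ] H) (ξ (g⁻¹ * h))
  rw [mul_inv_rev, inv_inv, map_mul]
  rfl

open Classical in
theorem condExpB_apply (x : (crossedProduct σ).Elem) (ξ : H) :
    (condExpB σ x : H →L[ℂ] H) ξ = x.1 (lp.single 2 1 ξ) 1 := rfl

open Classical in
theorem inner_condExpB (x : (crossedProduct σ).Elem) (ξ η : H) :
    inner ℂ η ((condExpB σ x : H →L[ℂ] H) ξ)
      = inner ℂ (lp.single 2 (1 : Γ) η) (x.1 (lp.single 2 1 ξ)) := by
  rw [lp.inner_single_left, condExpB_apply]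

open Classical in
theorem condExpB_crossedUnitary_inv_mul_apply (x : (crossedProduct σ).Elem) (g : Γ) (ξ : H) :
    (condExpB σ (crossedUnitary σ g⁻¹ * x) : H →L[ℂ] H) ξ = x.1 (lp.single 2 1 ξ) g := by
  rw [condExpB_apply]
  change leftTranslation g⁻¹ (x.1 (lp.single 2 1 ξ)) 1 = _
  rw [leftTranslation_apply, inv_inv, mul_one]

theorem condExpB_star (x : (crossedProduct σ).Elem) :
    condExpB σ (star x) = star (condExpB σ x) := by
  classical
  refine Subtype.ext ?_
  change (condExpB σ (star x) : H →L[ℂ] H) = star (condExpB σ x : H →L[ℂ] H)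
  rw [ContinuousLinearMap.star_eq_adjoint, ContinuousLinearMap.eq_adjoint_iff]
  intro ξ η
  rw [inner_condExpB, ← inner_conj_symm, inner_condExpB, inner_conj_symm]
  exact ContinuousLinearMap.adjoint_inner_left _ _ _

theorem condExpB_crossedIncl_mul (b : B.Elem) (x : (crossedProduct σ).Elem) :
    condExpB σ (crossedIncl σ b * x) = b * condExpB σ x := by
  classical
  ext ξ
  change (σ 1⁻¹ b : H →L[ℂ] H) (x.1 (lp.single 2 1 ξ) 1) = _
  rw [inv_one, map_one]
  rfl

theorem condExpB_mul_crossedIncl (b : B.Elem) (x : (crossedProduct σ).Elem) :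
    condExpB σ (x * crossedIncl σ b) = condExpB σ x * b := by
  have h := condExpB_crossedIncl_mul σ (star b) (star x)
  rw [← star_crossedIncl, ← star_mul, condExpB_star, condExpB_star, ← star_mul] at h
  exact star_injective h

theorem condExpB_one : condExpB σ 1 = 1 := by
  classical
  ext ξ
  rw [condExpB_apply]
  change (lp.single (E := fun _ : Γ => H) 2 (1 : Γ) ξ : Γ → H) 1 = ξ
  simp

theorem condExpB_crossedUnitary_of_ne {g : Γ} (hg : g ≠ 1) :
    condExpB σ (crossedUnitary σ g) = 0 := by
  classical
  ext ξ
  rw [condExpB_apply]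
  change leftTranslation g (lp.single 2 (1 : Γ) ξ) 1 = 0
  rw [leftTranslation_apply, lp.single_apply_ne]
  simpa using hg

/-- Two functionals `x ↦ τ(E(p x q))` agree as soon as they agree on the elements `b u_g`. -/
theorem crossedTrace_sandwich_eq {τ : B.Elem →ₗ[ℂ] ℂ} (hτ : IsNormalFaithfulTrace B τ)
    (p q p' q' : (crossedProduct σ).Elem)
    (h : ∀ (b : B.Elem) (g : Γ), crossedTrace σ τ (p * (crossedIncl σ b * crossedUnitary σ g) * q)
      = crossedTrace σ τ (p' * (crossedIncl σ b * crossedUnitary σ g) * q'))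
    (x : (crossedProduct σ).Elem) :
    crossedTrace σ τ (p * x * q) = crossedTrace σ τ (p' * x * q') := by
  classical
  obtain ⟨ξ, η, hξ, hη, hnormal⟩ := hτ.normal
  -- Normality of `τ` passes to the sandwiched functional: `q` is absorbed into the vectors `ξ k`,
  -- and `star p` into the `η k`.
  have key : ∀ p q x : (crossedProduct σ).Elem, crossedTrace σ τ (p * x * q)
      = ∑' k, inner ℂ ((star p).1 (lp.single 2 1 (η k)))
          (x.1 (q.1 (lp.single 2 1 (ξ k)))) := by
    intro p q x
    refine (hnormal (condExpB σ (p * x * q))).tsum_eq.symm.trans (tsum_congr fun k => ?_)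
    rw [inner_condExpB]
    exact (ContinuousLinearMap.adjoint_inner_left p.1 (x.1 (q.1 (lp.single 2 1 (ξ k))))
      (lp.single 2 1 (η k))).symm
  have bound : ∀ (q : (crossedProduct σ).Elem) {ζ : ℕ → H}, (Summable fun k => ‖ζ k‖ ^ 2) →
      Summable fun k => ‖q.1 (lp.single 2 1 (ζ k))‖ ^ 2 := by
    intro q ζ hζ
    refine Summable.of_nonneg_of_le (fun _ => by positivity) (fun k => ?_)
      (hζ.mul_left (‖q.1‖ ^ 2))
    rw [← mul_pow]
    gcongr
    refine (q.1.le_opNorm _).trans_eq ?_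
    rw [lp.norm_single (by norm_num)]
  let T : Set (lp (fun _ : Γ => H) 2 →L[ℂ] lp (fun _ : Γ => H) 2) :=
    {t | ∃ (b : B.Elem) (g : Γ), t = (crossedIncl σ b * crossedUnitary σ g).1}
  rw [key, key]
  refine eq_of_hasSum_of_bicommutant T ?_ ?_ ?_ x.1 ?_ (bound _ hξ) (bound _ hη) (bound _ hξ)
    (bound _ hη) ?_
  · exact ⟨1, 1, by rw [crossedIncl_one, crossedUnitary_one, mul_one]; rfl⟩
  · rintro _ ⟨a, g, rfl⟩ _ ⟨b, h, rfl⟩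
    refine ⟨a * σ g b, g * h, ?_⟩
    rw [crossedIncl_mul, crossedUnitary_mul, mul_assoc, ← mul_assoc (crossedIncl σ (σ g b)),
      ← crossedUnitary_mul_crossedIncl]
    simp only [← mul_assoc]
    rfl
  · rintro _ ⟨a, g, rfl⟩
    refine ⟨σ g⁻¹ (star a), g⁻¹, ?_⟩
    rw [← crossedUnitary_mul_crossedIncl, ← star_crossedIncl, ← star_crossedUnitary, ← star_mul]
    rfl
  · intro c hc
    have hmem : c ∈ StarSubalgebra.centralizer ℂ
        (Set.range (crossedRep σ) ∪ Set.range (leftTranslation (H := H) (Γ := Γ))) := by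
      rw [StarSubalgebra.mem_centralizer_iff]
      rintro _ (⟨b, rfl⟩ | ⟨g, rfl⟩)
      · have aux : ∀ b, (crossedIncl σ b).1 ∈ T := fun b =>
          ⟨b, 1, by rw [crossedUnitary_one, mul_one]⟩
        refine ⟨hc _ (aux b), ?_⟩
        have := hc _ (aux (star b))
        rwa [← star_crossedIncl] at this
      · have aux : ∀ g, (crossedUnitary σ g).1 ∈ T := fun g =>
          ⟨1, g, by rw [crossedIncl_one, one_mul]⟩
        refine ⟨hc _ (aux g), ?_⟩
        have := hc _ (aux g⁻¹)
        rwa [← star_crossedUnitary] at this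
    exact ((StarSubalgebra.mem_centralizer_iff ℂ).1 x.2 _ hmem).1
  · rintro _ ⟨b, g, rfl⟩
    rw [← key, ← key]
    exact h b g

/-- The conditional expectation intertwines `Ad u_g` and `σ_g`. -/
theorem condExpB_conj {τ : B.Elem →ₗ[ℂ] ℂ} (hτ : IsNormalFaithfulTrace B τ)
    (hσ : ∀ (g : Γ) (b : B.Elem), τ (σ g b) = τ b) (g : Γ) (x : (crossedProduct σ).Elem) :
    condExpB σ (crossedUnitary σ g * x * crossedUnitary σ g⁻¹) = σ g (condExpB σ x) := by
  have key : ∀ b : B.Elem, τ (b * condExpB σ (crossedUnitary σ g * x * crossedUnitary σ g⁻¹))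
      = τ (b * σ g (condExpB σ x)) := by
    intro b
    have h1 : b * σ g (condExpB σ x) = σ g (condExpB σ (crossedIncl σ (σ g⁻¹ b) * x)) := by
      rw [condExpB_crossedIncl_mul, map_mul, ← StarAlgEquiv.mul_apply, ← map_mul, mul_inv_cancel,
        map_one]
      rfl
    rw [h1, hσ, ← condExpB_crossedIncl_mul, ← mul_assoc, ← mul_assoc]
    have := crossedTrace_sandwich_eq σ hτ (crossedIncl σ b * crossedUnitary σ g)
      (crossedUnitary σ g⁻¹) (crossedIncl σ (σ g⁻¹ b)) 1 ?_ x
    · rwa [mul_one] at this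
    -- On a monomial `c u_h` both sides vanish unless `h = 1`, when invariance of `τ` gives
    -- equality.
    intro c h
    have e1 : crossedIncl σ b * crossedUnitary σ g * (crossedIncl σ c * crossedUnitary σ h)
        * crossedUnitary σ g⁻¹ = crossedIncl σ (b * σ g c) * crossedUnitary σ (g * h * g⁻¹) := by
      rw [crossedUnitary_mul, crossedUnitary_mul, crossedIncl_mul, mul_assoc (crossedIncl σ b),
        ← mul_assoc (crossedUnitary σ g), crossedUnitary_mul_crossedIncl]
      simp only [mul_assoc]
    rw [e1, mul_one, ← mul_assoc, ← crossedIncl_mul]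
    change τ (condExpB σ _) = τ (condExpB σ _)
    rw [condExpB_crossedIncl_mul, condExpB_crossedIncl_mul]
    by_cases hh : h = 1
    · subst hh
      rw [mul_one, mul_inv_cancel, crossedUnitary_one, condExpB_one, mul_one, mul_one,
        ← hσ g (_ * c), map_mul (σ g), ← StarAlgEquiv.mul_apply, ← map_mul, mul_inv_cancel, map_one]
      rfl
    · rw [condExpB_crossedUnitary_of_ne σ hh, condExpB_crossedUnitary_of_ne, mul_zero, mul_zero]
      simpa [mul_inv_eq_one] using hh
  rw [← sub_eq_zero]
  -- `key` is applied with `b` the adjoint of the difference.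
  refine hτ.faithful _ ?_
  rw [mul_sub, map_sub, key, sub_self]

end CrossedAlgebra

/-! ### Estimates for the 2-norm -/

theorem CStarAlgebra.exists_star_mul_self_eq_norm_sq_sub {A : Type*} [CStarAlgebra A] (a : A) :
    ∃ c : A, star c * c = algebraMap ℝ A (‖a‖ ^ 2) - star a * a := by
  let := CStarAlgebra.spectralOrder A
  have := CStarAlgebra.spectralOrderedRing A
  obtain ⟨c, hc⟩ := CStarAlgebra.nonneg_iff_eq_star_mul_self.1
    (sub_nonneg.2 (CStarAlgebra.star_mul_le_algebraMap_norm_sq (a := a)))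
  exact ⟨c, hc.symm⟩

section TwoNorm

variable {H : Type u} [NormedAddCommGroup H] [InnerProductSpace ℂ H] [CompleteSpace H]
variable {A : VonNeumannAlgebra H}

/-- The square `φ(b* b)` of the `2`-norm. -/
noncomputable def twoNormSq (φ : A.Elem →ₗ[ℂ] ℂ) (b : A.Elem) : ℝ := (φ (star b * b)).re

theorem twoNormSq_nonneg {φ : A.Elem →ₗ[ℂ] ℂ} (hφ : ∀ b, 0 ≤ φ (star b * b)) (b : A.Elem) :
    0 ≤ twoNormSq φ b := (Complex.le_def.1 (hφ b)).1

theorem tendsto_twoNorm_iff {φ : A.Elem →ₗ[ℂ] ℂ} (hφ : ∀ b, 0 ≤ φ (star b * b))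
    {α : Type*} {l : Filter α} {f : α → A.Elem} :
    Filter.Tendsto (fun n => twoNorm φ (f n)) l (𝓝 0) ↔
      Filter.Tendsto (fun n => twoNormSq φ (f n)) l (𝓝 0) := by
  refine ⟨fun h => ?_, fun h => ?_⟩
  · have := h.pow 2
    simp only [twoNorm] at this
    rw [zero_pow two_ne_zero] at this
    exact this.congr fun n => Real.sq_sqrt (twoNormSq_nonneg hφ _)
  · have := (Real.continuous_sqrt.tendsto 0).comp h
    rwa [Real.sqrt_zero] at this

/-- The parallelogram law with one nonnegative term dropped; no Cauchy–Schwarz inequality is needed.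
-/
theorem twoNormSq_add_le {φ : A.Elem →ₗ[ℂ] ℂ} (hφ : ∀ b, 0 ≤ φ (star b * b)) (a b : A.Elem) :
    twoNormSq φ (a + b) ≤ 2 * twoNormSq φ a + 2 * twoNormSq φ b := by
  have h : twoNormSq φ (a + b) + twoNormSq φ (a - b)
      = 2 * twoNormSq φ a + 2 * twoNormSq φ b := by
    simp only [twoNormSq, star_add, star_sub, add_mul, mul_add, sub_mul, mul_sub, map_add, map_sub,
      Complex.add_re, Complex.sub_re]
    ring
  have := twoNormSq_nonneg hφ (a - b)
  linarith

/-- With $c^*c=\|a\|^2-a^*a$, this is the inequality $\varphi((cb)^*(cb))\ge0$. -/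
theorem twoNormSq_mul_le {φ : A.Elem →ₗ[ℂ] ℂ} (hφ : ∀ b, 0 ≤ φ (star b * b)) (a b : A.Elem) :
    twoNormSq φ (a * b) ≤ ‖a‖ ^ 2 * twoNormSq φ b := by
  obtain ⟨c, hc⟩ := CStarAlgebra.exists_star_mul_self_eq_norm_sq_sub a
  have h2 := (Complex.le_def.1 (hφ (c * b))).1
  have e : star (c * b) * (c * b) = ((‖a‖ ^ 2 : ℝ) : ℂ) • (star b * b)
      - star (a * b) * (a * b) := by
    rw [star_mul, star_mul, mul_assoc, ← mul_assoc (star c), hc, sub_mul, mul_sub,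
      mul_assoc (star a), mul_assoc (star b) (star a)]
    congr 1
    rw [Algebra.algebraMap_eq_smul_one, smul_one_mul, mul_smul_comm]
    exact (Complex.coe_smul _ _).symm
  rw [e, map_sub, map_smul, smul_eq_mul, Complex.sub_re, Complex.re_ofReal_mul,
    Complex.zero_re] at h2
  simpa [twoNormSq] using h2

theorem IsNormalFaithfulTrace.twoNormSq_star {τ : A.Elem →ₗ[ℂ] ℂ} (hτ : IsNormalFaithfulTrace A τ)
    (b : A.Elem) : twoNormSq τ (star b) = twoNormSq τ b := by
  rw [twoNormSq, star_star, hτ.tracial, twoNormSq]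

theorem twoNormSq_mul_le_of_star {φ : A.Elem →ₗ[ℂ] ℂ} (hφ : ∀ b, 0 ≤ φ (star b * b))
    (hstar : ∀ b, twoNormSq φ (star b) = twoNormSq φ b) (a b : A.Elem) :
    twoNormSq φ (a * b) ≤ ‖b‖ ^ 2 * twoNormSq φ a := by
  rw [← hstar, star_mul, ← hstar a, ← norm_star b]
  exact twoNormSq_mul_le hφ _ _

theorem IsNormalFaithfulTrace.eq_zero_of_twoNormSq {τ : A.Elem →ₗ[ℂ] ℂ}
    (hτ : IsNormalFaithfulTrace A τ) {b : A.Elem} (h : twoNormSq τ b = 0) : b = 0 :=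
  hτ.faithful b (Complex.ext h (Complex.le_def.1 (hτ.nonneg b)).2.symm)

end TwoNorm

/-! ### Parseval's identity -/

section Parseval

variable {H : Type u} [NormedAddCommGroup H] [InnerProductSpace ℂ H] [CompleteSpace H]
variable {B : VonNeumannAlgebra H} {Γ : Type v} [Group Γ]
variable (σ : Γ →* (B.Elem ≃⋆ₐ[ℂ] B.Elem)) {τ : B.Elem →ₗ[ℂ] ℂ}

open Classical in
theorem inner_condExpB_star_mul (x y : (crossedProduct σ).Elem) (ξ η : H) :
    inner ℂ η ((condExpB σ (star x * y) : H →L[ℂ] H) ξ)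
      = inner ℂ (x.1 (lp.single 2 1 η)) (y.1 (lp.single 2 1 ξ)) := by
  rw [inner_condExpB]
  exact ContinuousLinearMap.adjoint_inner_right x.1 (lp.single 2 1 η) (y.1 (lp.single 2 1 ξ))

/-- A double family over `ℕ × Γ`, from the normal form of `τ` and the entries of the columns of `x`,
is summed in both orders: over `Γ` first it yields the trace of `star x * x`, over `ℕ` first the
terms indexed by `g`. -/
theorem hasSum_trace_condExpB_inv_mul (hτ : IsNormalFaithfulTrace B τ)
    (x : (crossedProduct σ).Elem) :
    HasSum (fun g => τ (star (condExpB σ (crossedUnitary σ g⁻¹ * x))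
      * condExpB σ (crossedUnitary σ g⁻¹ * x))) (crossedTrace σ τ (star x * x)) := by
  classical
  obtain ⟨ξ, η, hξ, hη, hnormal⟩ := hτ.normal
  have hsq : ∀ {ζ : ℕ → H}, (Summable fun k => ‖ζ k‖ ^ 2) →
      Summable fun p : ℕ × Γ => ‖x.1 (lp.single 2 1 (ζ p.1)) p.2‖ ^ 2 := by
    intro ζ hζ
    have hn : ∀ k, HasSum (fun g => ‖x.1 (lp.single 2 1 (ζ k)) g‖ ^ 2)
        (‖x.1 (lp.single 2 1 (ζ k))‖ ^ 2) := fun k => by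
      simpa using lp.hasSum_norm (p := 2) (by norm_num) (x.1 (lp.single 2 1 (ζ k)))
    refine (summable_prod_of_nonneg fun _ => by positivity).2 ⟨fun k => (hn k).summable, ?_⟩
    refine Summable.of_nonneg_of_le (fun _ => tsum_nonneg fun _ => by positivity) (fun k => ?_)
      (hζ.mul_left (‖x.1‖ ^ 2))
    rw [(hn k).tsum_eq, ← mul_pow]
    gcongr
    refine (x.1.le_opNorm _).trans_eq ?_
    rw [lp.norm_single (by norm_num)]
  let F : ℕ × Γ → ℂ := fun p =>
    inner ℂ (x.1 (lp.single 2 1 (η p.1)) p.2) (x.1 (lp.single 2 1 (ξ p.1)) p.2)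
  have hF : Summable F := by
    refine Summable.of_norm_bounded ((hsq hη).add (hsq hξ)) fun p =>
      (norm_inner_le_norm _ _).trans ?_
    nlinarith [sq_nonneg (‖x.1 (lp.single 2 1 (η p.1)) p.2‖ - ‖x.1 (lp.single 2 1 (ξ p.1)) p.2‖),
      sq_nonneg ‖x.1 (lp.single 2 1 (η p.1)) p.2‖, sq_nonneg ‖x.1 (lp.single 2 1 (ξ p.1)) p.2‖]
  have h1 : HasSum F (crossedTrace σ τ (star x * x)) := by
    have hk : ∀ k, HasSum (fun g => F (k, g))
        (inner ℂ (η k) ((condExpB σ (star x * x) : H →L[ℂ] H) (ξ k))) := by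
      intro k
      rw [inner_condExpB_star_mul]
      exact lp.hasSum_inner (x.1 (lp.single 2 1 (η k))) (x.1 (lp.single 2 1 (ξ k)))
    have h := (hF.hasSum.prod_fiberwise hk).unique (hnormal (condExpB σ (star x * x)))
    have h' := hF.hasSum
    rwa [h] at h'
  refine ((Equiv.prodComm Γ ℕ).hasSum_iff.2 h1).prod_fiberwise fun g => ?_
  refine (congrArg (fun F => HasSum F _) (funext fun k => ?_)).mpr (hnormal _)
  change inner ℂ (x.1 (lp.single 2 1 (η k)) g) (x.1 (lp.single 2 1 (ξ k)) g) = _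
  rw [← condExpB_crossedUnitary_inv_mul_apply, ← condExpB_crossedUnitary_inv_mul_apply]
  exact (ContinuousLinearMap.adjoint_inner_right _ _ _).symm

theorem crossedTrace_nonneg (hτ : IsNormalFaithfulTrace B τ) (x : (crossedProduct σ).Elem) :
    0 ≤ crossedTrace σ τ (star x * x) :=
  (hasSum_trace_condExpB_inv_mul σ hτ x).nonneg fun _ => hτ.nonneg _

theorem twoNormSq_action (hσ : ∀ (g : Γ) (b : B.Elem), τ (σ g b) = τ b) (g : Γ) (b : B.Elem) :
    twoNormSq τ (σ g b) = twoNormSq τ b := by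
  rw [twoNormSq, ← map_star (σ g), ← map_mul (σ g), hσ, twoNormSq]

theorem crossedCoeff_eq (hτ : IsNormalFaithfulTrace B τ)
    (hσ : ∀ (g : Γ) (b : B.Elem), τ (σ g b) = τ b) (x : (crossedProduct σ).Elem) (g : Γ) :
    crossedCoeff σ x g = σ g (condExpB σ (crossedUnitary σ g⁻¹ * x)) := by
  rw [← condExpB_conj σ hτ hσ, ← mul_assoc, crossedUnitary_mul_inv, one_mul, crossedCoeff,
    star_crossedUnitary]

theorem hasSum_twoNormSq_condExpB (hτ : IsNormalFaithfulTrace B τ) (x : (crossedProduct σ).Elem) :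
    HasSum (fun g => twoNormSq τ (condExpB σ (crossedUnitary σ g⁻¹ * x)))
      (twoNormSq (crossedTrace σ τ) x) :=
  (hasSum_trace_condExpB_inv_mul σ hτ x).mapL Complex.reCLM

/-- Parseval's identity for the Fourier expansion in the crossed product. -/
theorem hasSum_twoNormSq_crossedCoeff (hτ : IsNormalFaithfulTrace B τ)
    (hσ : ∀ (g : Γ) (b : B.Elem), τ (σ g b) = τ b) (x : (crossedProduct σ).Elem) :
    HasSum (fun g => twoNormSq τ (crossedCoeff σ x g)) (twoNormSq (crossedTrace σ τ) x) := by
  simp_rw [crossedCoeff_eq σ hτ hσ, twoNormSq_action σ hσ]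
  exact hasSum_twoNormSq_condExpB σ hτ x

/-- Since $(x^*)_g=E_B(u_gx)^*$ and `τ` is tracial, this is Parseval's sum for $x$ reindexed by
$g\mapsto g^{-1}$. It is all that is used of the traciality of $\tau\circ E_B$. -/
theorem twoNormSq_crossedTrace_star (hτ : IsNormalFaithfulTrace B τ)
    (hσ : ∀ (g : Γ) (b : B.Elem), τ (σ g b) = τ b) (x : (crossedProduct σ).Elem) :
    twoNormSq (crossedTrace σ τ) (star x) = twoNormSq (crossedTrace σ τ) x := by
  refine (hasSum_twoNormSq_crossedCoeff σ hτ hσ (star x)).unique ?_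
  have h := (Equiv.inv Γ).hasSum_iff.2 (hasSum_twoNormSq_condExpB σ hτ x)
  refine (congrArg (fun F => HasSum F _) (funext fun g => ?_)).mpr h
  rw [crossedCoeff, ← star_mul, condExpB_star, hτ.twoNormSq_star]
  simp

/-- The left side is the term `g = 1` of Parseval's sum. -/
theorem twoNormSq_condExpB_le (hτ : IsNormalFaithfulTrace B τ) (x : (crossedProduct σ).Elem) :
    twoNormSq τ (condExpB σ x) ≤ twoNormSq (crossedTrace σ τ) x := by
  have h := le_hasSum (hasSum_twoNormSq_condExpB σ hτ x) 1
    fun g _ => twoNormSq_nonneg hτ.nonneg _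
  rwa [inv_one, crossedUnitary_one, one_mul] at h

end Parseval

/-! ### Existence and uniqueness of the Fourier expansion -/

section Fourier

variable {H : Type u} [NormedAddCommGroup H] [InnerProductSpace ℂ H] [CompleteSpace H]
variable {B : VonNeumannAlgebra H} {Γ : Type v} [Group Γ]
variable (σ : Γ →* (B.Elem ≃⋆ₐ[ℂ] B.Elem)) {τ : B.Elem →ₗ[ℂ] ℂ}

open Classical in
theorem crossedCoeff_crossedIncl_mul_crossedUnitary (b : B.Elem) (h g : Γ) :
    crossedCoeff σ (crossedIncl σ b * crossedUnitary σ h) g = if g = h then b else 0 := by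
  rw [crossedCoeff, star_crossedUnitary, mul_assoc, ← crossedUnitary_mul, condExpB_crossedIncl_mul]
  split_ifs with hg
  · rw [hg, mul_inv_cancel, crossedUnitary_one, condExpB_one, mul_one]
  · rw [condExpB_crossedUnitary_of_ne, mul_zero]
    rwa [ne_eq, mul_inv_eq_one, eq_comm]

open Classical in
theorem crossedCoeff_sub_sum (x : (crossedProduct σ).Elem) (c : Γ → B.Elem) (F : Finset Γ) (g : Γ) :
    crossedCoeff σ (x - ∑ h ∈ F, crossedIncl σ (c h) * crossedUnitary σ h) g
      = crossedCoeff σ x g - if g ∈ F then c g else 0 := by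
  have := crossedCoeff_crossedIncl_mul_crossedUnitary σ
  unfold crossedCoeff at this ⊢
  rw [sub_mul, map_sub, Finset.sum_mul, map_sum]
  simp_rw [this]
  rw [Finset.sum_ite_eq]

theorem tendsto_twoNormSq_sub_sum_crossedCoeff (hτ : IsNormalFaithfulTrace B τ)
    (hσ : ∀ (g : Γ) (b : B.Elem), τ (σ g b) = τ b) (x : (crossedProduct σ).Elem) :
    Filter.Tendsto (fun F : Finset Γ => twoNormSq (crossedTrace σ τ)
      (x - ∑ g ∈ F, crossedIncl σ (crossedCoeff σ x g) * crossedUnitary σ g))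
      Filter.atTop (𝓝 0) := by
  classical
  have hsum := hasSum_twoNormSq_crossedCoeff σ hτ hσ x
  have h : ∀ F : Finset Γ, twoNormSq (crossedTrace σ τ)
      (x - ∑ g ∈ F, crossedIncl σ (crossedCoeff σ x g) * crossedUnitary σ g)
      -- Subtracting a partial sum removes exactly the coefficients in `F`, so the squared error is
      -- the tail of Parseval's sum.
      = twoNormSq (crossedTrace σ τ) x - ∑ g ∈ F, twoNormSq τ (crossedCoeff σ x g) := by
    intro F
    refine (hasSum_twoNormSq_crossedCoeff σ hτ hσ _).unique ?_
    have hF := hasSum_sum_of_ne_finset_zero (s := F)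
      (f := fun g => if g ∈ F then twoNormSq τ (crossedCoeff σ x g) else 0)
      (L := SummationFilter.unconditional Γ) fun g hg => if_neg hg
    rw [Finset.sum_congr rfl fun g hg => if_pos hg] at hF
    refine (congrArg (fun F => HasSum F _) (funext fun g => ?_)).mpr (hsum.sub hF)
    rw [crossedCoeff_sub_sum]
    split_ifs <;> simp [twoNormSq]
  simp_rw [h]
  simpa using hsum.const_sub (twoNormSq (crossedTrace σ τ) x)

/-- The Fourier expansion of an element of the crossed product exists and is unique. -/
theorem hasFourierExpansion_iff (hτ : IsNormalFaithfulTrace B τ)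
    (hσ : ∀ (g : Γ) (b : B.Elem), τ (σ g b) = τ b) (x : (crossedProduct σ).Elem)
    (c : Γ → B.Elem) : HasFourierExpansion σ τ x c ↔ ∀ g, c g = crossedCoeff σ x g := by
  classical
  rw [HasFourierExpansion, tendsto_twoNorm_iff (crossedTrace_nonneg σ hτ)]
  refine ⟨fun h g => ?_, fun h => ?_⟩
  -- Once `g ∈ F`, the left side is one Parseval term of the error, which tends to `0`.
  · have hle : twoNormSq τ (crossedCoeff σ x g - c g) ≤ 0 := by
      refine ge_of_tendsto h ((Filter.eventually_ge_atTop {g}).mono fun F hF => ?_)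
      have := le_hasSum (hasSum_twoNormSq_crossedCoeff σ hτ hσ
        (x - ∑ h ∈ F, crossedIncl σ (c h) * crossedUnitary σ h)) g
        fun _ _ => twoNormSq_nonneg hτ.nonneg _
      rwa [crossedCoeff_sub_sum, if_pos (hF (Finset.mem_singleton_self g))] at this
    have := hτ.eq_zero_of_twoNormSq (le_antisymm hle (twoNormSq_nonneg hτ.nonneg _))
    exact (sub_eq_zero.1 this).symm
  · obtain rfl : c = crossedCoeff σ x := funext h
    exact tendsto_twoNormSq_sub_sum_crossedCoeff σ hτ hσ x

end Fourier

/-! ### From vanishing coefficients to mixing -/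

section Mixing

variable {H : Type u} [NormedAddCommGroup H] [InnerProductSpace ℂ H] [CompleteSpace H]
variable {B : VonNeumannAlgebra H} {Γ : Type v} [Group Γ]
variable (σ : Γ →* (B.Elem ≃⋆ₐ[ℂ] B.Elem)) {τ : B.Elem →ₗ[ℂ] ℂ}

theorem tendsto_zero_of_forall_le_add {f : ℕ → ℝ} (hf : ∀ n, 0 ≤ f n)
    (h : ∀ ε > 0, ∃ s : ℕ → ℝ, Filter.Tendsto s Filter.atTop (𝓝 0) ∧ ∀ n, f n ≤ s n + ε) :
    Filter.Tendsto f Filter.atTop (𝓝 0) := by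
  rw [Metric.tendsto_atTop]
  intro ε hε
  obtain ⟨s, hs, hle⟩ := h (ε / 2) (half_pos hε)
  obtain ⟨N, hN⟩ := Metric.tendsto_atTop.1 hs (ε / 2) (half_pos hε)
  refine ⟨N, fun n hn => ?_⟩
  have h1 := hN n hn
  rw [Real.dist_eq, sub_zero] at h1 ⊢
  rw [abs_of_nonneg (hf n)]
  linarith [hle n, le_abs_self (s n)]

theorem tendsto_twoNormSq_add {A : VonNeumannAlgebra H} {φ : A.Elem →ₗ[ℂ] ℂ}
    (hφ : ∀ b, 0 ≤ φ (star b * b)) {a b : ℕ → A.Elem}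
    (ha : Filter.Tendsto (fun n => twoNormSq φ (a n)) Filter.atTop (𝓝 0))
    (hb : Filter.Tendsto (fun n => twoNormSq φ (b n)) Filter.atTop (𝓝 0)) :
    Filter.Tendsto (fun n => twoNormSq φ (a n + b n)) Filter.atTop (𝓝 0) := by
  refine squeeze_zero (fun n => twoNormSq_nonneg hφ _) (fun n => twoNormSq_add_le hφ _ _) ?_
  simpa using (ha.const_mul 2).add (hb.const_mul 2)

theorem tendsto_twoNormSq_sum {A : VonNeumannAlgebra H} {φ : A.Elem →ₗ[ℂ] ℂ}
    (hφ : ∀ b, 0 ≤ φ (star b * b)) {ι : Type*} (F : Finset ι) {a : ι → ℕ → A.Elem}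
    (ha : ∀ i, Filter.Tendsto (fun n => twoNormSq φ (a i n)) Filter.atTop (𝓝 0)) :
    Filter.Tendsto (fun n => twoNormSq φ (∑ i ∈ F, a i n)) Filter.atTop (𝓝 0) := by
  classical
  induction F using Finset.induction_on with
  | empty => simp [twoNormSq]
  | insert i F hi ih =>
    simp_rw [Finset.sum_insert hi]
    exact tendsto_twoNormSq_add hφ (ha i) ih

/-- Here $cu_h=u_h\sigma_{h^{-1}}(c)$, and equivariance turns $E_B(u_gwu_h)$ into
$\sigma_g(E_B(wu_{hg}))$. -/
theorem condExpB_monomial_mul_mul_monomial (hτ : IsNormalFaithfulTrace B τ)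
    (hσ : ∀ (g : Γ) (b : B.Elem), τ (σ g b) = τ b) (a c : B.Elem) (g h : Γ)
    (w : (crossedProduct σ).Elem) :
    condExpB σ (crossedIncl σ a * crossedUnitary σ g * w * (crossedIncl σ c * crossedUnitary σ h))
      = a * (σ g (crossedCoeff σ w (h * g)⁻¹) * σ h⁻¹ c) := by
  have e : crossedIncl σ c * crossedUnitary σ h
      = crossedUnitary σ h * crossedIncl σ (σ h⁻¹ c) := by
    rw [crossedUnitary_mul_crossedIncl, ← StarAlgEquiv.mul_apply, ← map_mul, mul_inv_cancel,
      map_one]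
    rfl
  rw [e, ← mul_assoc, condExpB_mul_crossedIncl, mul_assoc, mul_assoc, condExpB_crossedIncl_mul,
    crossedCoeff, star_crossedUnitary, inv_inv, ← condExpB_conj σ hτ hσ, crossedUnitary_mul]
  simp only [mul_assoc]
  rw [crossedUnitary_mul_inv, mul_one]

theorem tendsto_condExpB_of_tendsto_crossedCoeff (hτ : IsNormalFaithfulTrace B τ)
    (hσ : ∀ (g : Γ) (b : B.Elem), τ (σ g b) = τ b) (v : ℕ → unitary (crossedProduct σ).Elem)
    (hv : ∀ g, Filter.Tendsto (fun n => twoNormSq τ (crossedCoeff σ (v n) g)) Filter.atTop (𝓝 0))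
    (x y : (crossedProduct σ).Elem) :
    Filter.Tendsto (fun n => twoNormSq τ (condExpB σ (x * v n * y))) Filter.atTop (𝓝 0) := by
  have hpos := crossedTrace_nonneg σ hτ
  have happrox : ∀ (z : (crossedProduct σ).Elem) (C : ℝ), ∀ ε > 0, ∃ F : Finset Γ,
      C * twoNormSq (crossedTrace σ τ)
        (z - ∑ g ∈ F, crossedIncl σ (crossedCoeff σ z g) * crossedUnitary σ g) < ε := by
    intro z C ε hε
    have := (tendsto_twoNormSq_sub_sum_crossedCoeff σ hτ hσ z).const_mul C
    rw [mul_zero] at this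
    exact (this.eventually_lt_const hε).exists
  have hmono : ∀ (a c : B.Elem) (g h : Γ), Filter.Tendsto (fun n => twoNormSq τ (condExpB σ
      (crossedIncl σ a * crossedUnitary σ g * v n * (crossedIncl σ c * crossedUnitary σ h))))
      Filter.atTop (𝓝 0) := by
    intro a c g h
    have hlim := ((hv (h * g)⁻¹).const_mul (‖σ h⁻¹ c‖ ^ 2)).const_mul (‖a‖ ^ 2)
    rw [mul_zero, mul_zero] at hlim
    refine squeeze_zero (fun n => twoNormSq_nonneg hτ.nonneg _) (fun n => ?_) hlim
    rw [condExpB_monomial_mul_mul_monomial σ hτ hσ]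
    refine (twoNormSq_mul_le hτ.nonneg _ _).trans ?_
    gcongr
    refine (twoNormSq_mul_le_of_star hτ.nonneg hτ.twoNormSq_star _ _).trans_eq ?_
    rw [twoNormSq_action σ hσ]
  have hpoly : ∀ (F : Finset Γ) (c : Γ → B.Elem), Filter.Tendsto (fun n => twoNormSq τ (condExpB σ
      (x * v n * ∑ h ∈ F, crossedIncl σ (c h) * crossedUnitary σ h))) Filter.atTop (𝓝 0) := by
    intro F c
    set y' := ∑ h ∈ F, crossedIncl σ (c h) * crossedUnitary σ h with hy'
    refine tendsto_zero_of_forall_le_add (fun n => twoNormSq_nonneg hτ.nonneg _) fun ε hε => ?_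
    -- The `2` is the constant of `twoNormSq_add_le`; `y'` is already fixed, so its norm may enter
    -- the accuracy demanded of `x'`.
    obtain ⟨F', hF'⟩ := happrox x (2 * ‖y'‖ ^ 2) ε hε
    set x' := ∑ g ∈ F', crossedIncl σ (crossedCoeff σ x g) * crossedUnitary σ g with hx'
    refine ⟨fun n => 2 * twoNormSq τ (condExpB σ (x' * v n * y')), ?_, fun n => ?_⟩
    · have hs : ∀ n, condExpB σ (x' * v n * y') = ∑ g ∈ F', ∑ h ∈ F, condExpB σ
          (crossedIncl σ (crossedCoeff σ x g) * crossedUnitary σ g * v n *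
            (crossedIncl σ (c h) * crossedUnitary σ h)) := by
        intro n
        rw [hx', hy']
        simp_rw [Finset.sum_mul, Finset.mul_sum, map_sum]
      simp_rw [hs]
      simpa using (tendsto_twoNormSq_sum hτ.nonneg F' fun g =>
        tendsto_twoNormSq_sum hτ.nonneg F fun h => hmono _ _ g h).const_mul 2
    · have e : condExpB σ (x * v n * y')
          = condExpB σ (x' * v n * y') + condExpB σ ((x - x') * (v n * y')) := by
        rw [← map_add, ← mul_assoc, sub_mul, sub_mul, add_sub_cancel]
      have h1 := twoNormSq_condExpB_le σ hτ ((x - x') * (v n * y'))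
      have h2 := twoNormSq_mul_le_of_star hpos (twoNormSq_crossedTrace_star σ hτ hσ) (x - x')
        (v n * y')
      -- Unitarity of `v n` makes the bound independent of `n`.
      rw [CStarRing.norm_coe_unitary_mul] at h2
      rw [e]
      refine (twoNormSq_add_le hτ.nonneg _ _).trans ?_
      linarith
  refine tendsto_zero_of_forall_le_add (fun n => twoNormSq_nonneg hτ.nonneg _) fun ε hε => ?_
  obtain ⟨F, hF⟩ := happrox y (2 * ‖x‖ ^ 2) ε hε
  set y' := ∑ g ∈ F, crossedIncl σ (crossedCoeff σ y g) * crossedUnitary σ g with hy'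
  refine ⟨fun n => 2 * twoNormSq τ (condExpB σ (x * v n * y')), ?_, fun n => ?_⟩
  · simpa using (hpoly F (crossedCoeff σ y)).const_mul 2
  · have e : condExpB σ (x * v n * y)
        = condExpB σ (x * v n * y') + condExpB σ (x * v n * (y - y')) := by
      rw [← map_add, mul_sub, add_sub_cancel]
    have h1 := twoNormSq_condExpB_le σ hτ (x * v n * (y - y'))
    have h2 := twoNormSq_mul_le hpos (x * v n) (y - y')
    rw [CStarRing.norm_mul_coe_unitary] at h2
    rw [e]
    refine (twoNormSq_add_le hτ.nonneg _ _).trans ?_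
    linarith

end Mixing

theorem proposition2p3 {H : Type u} [NormedAddCommGroup H] [InnerProductSpace ℂ H]
    [CompleteSpace H] (B : VonNeumannAlgebra H) (τ : B.Elem →ₗ[ℂ] ℂ)
    (hτ : IsNormalFaithfulTrace B τ) {Γ : Type v} [Group Γ]
    (σ : Γ →* (B.Elem ≃⋆ₐ[ℂ] B.Elem)) (hσ : ∀ (g : Γ) (b : B.Elem), τ (σ g b) = τ b)
    (v : ℕ → unitary (crossedProduct σ).Elem) :
    (∀ (n : ℕ) (c : Γ → B.Elem),
      HasFourierExpansion σ τ (v n) c ↔ ∀ g : Γ, c g = crossedCoeff σ (v n) g) ∧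
    ((∀ x y : (crossedProduct σ).Elem,
        Filter.Tendsto (fun n => twoNorm τ (condExpB σ (x * v n * y))) Filter.atTop (𝓝 0)) ↔
      ∀ g : Γ,
        Filter.Tendsto (fun n => twoNorm τ (crossedCoeff σ (v n) g)) Filter.atTop (𝓝 0)) := by
  refine ⟨fun n c => hasFourierExpansion_iff σ hτ hσ (v n) c, fun h g => ?_, fun h x y => ?_⟩
  · simpa only [one_mul, crossedCoeff] using h 1 (star (crossedUnitary σ g))
  · simp_rw [tendsto_twoNorm_iff hτ.nonneg] at h ⊢
    exact tendsto_condExpB_of_tendsto_crossedCoeff σ hτ hσ v h x y
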